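/- Let $d\ge 1$, let $\mathbb{B}_d=\{z\in\mathbb{C}^d:\|z\|<1\}$ be the Euclidean unit ball and let $\sigma$ be the Lebesgue surface measure on $\partial\mathbb{B}_d$. A holomorphic map $f=(f_1,\dots,f_d):\mathbb{B}_d\to\mathbb{B}_d$ has radial limits $\lim_{r\to1^-}f(r\xi)$ for $\sigma$-almost every $\xi\in\partial\mathbb{B}_d$; they define an element of $L^\infty(\partial\mathbb{B}_d,\sigma;\mathbb{C}^d)$, again denoted by $f$. For $g=(g_1,\dots,g_d)\in L^2(\partial\mathbb{B}_d,\sigma;\mathbb{C}^d)$ put $$\|g\|_{L^2(\partial\mathbb{B}_d)}^2=\sum_{j=1}^d\int_{\partial\mathbb{B}_d}|g_j|^2\,d\sigma ,$$ and let $T_{\mathbf 1}(f)(z)=f(0)+Df(0)z$ be the affine Taylor polynomial of $f$ at the origin. Every holomorphic automorphism $F$ of $\mathbb{B}_d$ can be written on $\mathbb{B}_d$ as $$F(z)=\frac{a^{(0)}+a^{(1)}z_1+\dots+a^{(d)}z_d}{b(z)},\qquad b(z)=b_0+b_1z_1+\dots+b_dz_d,$$ with $a^{(j)}\in\mathbb{C}^d$,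 $b_j\in\mathbb{C}$ and $b$ without zeros in $\overline{\mathbb{B}}_d$. To every $(b_0,\dots,b_d)\in\mathbb{C}^{d+1}$ one can associate a constant $C(b)>0$ such that, for every holomorphic automorphism $F$ of $\mathbb{B}_d$, every representation of $F$ as above with denominator $b$, and every holomorphic map $f:\mathbb{B}_d\to\mathbb{B}_d$, $$\|F-f\|_{L^2(\partial\mathbb{B}_d)}^2\le C(b)\left[d(d+1)\rho^2+\sqrt{d(d+1)}\,\rho\right],\qquad \rho=\|T_{\mathbf 1}(F)-T_{\mathbf 1}(f)\|_{L^2(\partial\mathbb{B}_d)} .$$ In particular the constant depends only on $F$, and only through its denominator. -/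

import Mathlib

open MeasureTheory Filter Topology Metric Set

noncomputable section

namespace BallSuperresolution

/-- The Hermitian space `ℂ^d` with its Euclidean norm. -/
abbrev Cd (d : ℕ) : Type := EuclideanSpace ℂ (Fin d)

/-- The open Euclidean unit ball of `ℂ^d`. -/
def unitBall (d : ℕ) : Set (Cd d) := ball 0 1

/-- The Euclidean unit sphere of `ℂ^d`, the boundary of the unit ball. -/
abbrev UnitSphere (d : ℕ) : Type := sphere (0 : Cd d) 1

/-- The Lebesgue surface measure on the unit sphere (induced by Lebesgue measure of
`ℂ^d = ℝ^(2d)`; it is not normalized). -/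
def surfaceMeasure (d : ℕ) : Measure (UnitSphere d) := (volume : Measure (Cd d)).toSphere

variable {d : ℕ}

/-- `f` restricts to a holomorphic map from the unit ball to itself. -/
def IsHolomorphicSelfMap (f : Cd d → Cd d) : Prop :=
  DifferentiableOn ℂ f (unitBall d) ∧ MapsTo f (unitBall d) (unitBall d)

/-- `F` restricts to a holomorphic automorphism of the unit ball: a holomorphic self-map with a
holomorphic inverse. -/
def IsBallAutomorphism (F : Cd d → Cd d) : Prop :=
  IsHolomorphicSelfMap F ∧
    ∃ G : Cd d → Cd d, IsHolomorphicSelfMap G ∧ InvOn G F (unitBall d) (unitBall d)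

/-- `f` has the radial limit `w` at the boundary point `ξ`. -/
def HasRadialLimit (f : Cd d → Cd d) (ξ : UnitSphere d) (w : Cd d) : Prop :=
  Tendsto (fun r : ℝ => f (r • (ξ : Cd d))) (𝓝[<] 1) (𝓝 w)

/-- The boundary function of `f`, defined through radial limits (arbitrary at the points
where the radial limit does not exist). -/
def boundaryValue (f : Cd d → Cd d) (ξ : UnitSphere d) : Cd d :=
  limUnder (𝓝[<] (1 : ℝ)) (fun r : ℝ => f (r • (ξ : Cd d)))

/-- The radial limits of `f` exist almost everywhere on the sphere and define an element
of `L^∞`. -/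
def HasBoundedBoundaryValues (f : Cd d → Cd d) : Prop :=
  (∀ᵐ ξ ∂surfaceMeasure d, ∃ w : Cd d, HasRadialLimit f ξ w) ∧
    MemLp (boundaryValue f) ⊤ (surfaceMeasure d)

/-- The norm of `L²` of the sphere for `ℂ^d`-valued functions `g = (g₁, …, g_d)`; its square is
the sum over `j` of the squared `L²` norms of the `g_j`. -/
def sphereL2Norm (g : UnitSphere d → Cd d) : ℝ := (eLpNorm g 2 (surfaceMeasure d)).toReal

/-- The affine Taylor polynomial of `f` at the origin, `z ↦ f(0) + Df(0) z`. -/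
def affineTaylor (f : Cd d → Cd d) (z : Cd d) : Cd d := f 0 + fderiv ℂ f 0 z

/-- The affine function `b₀ + b₁ z₁ + ⋯ + b_d z_d`. -/
def affineForm (b₀ : ℂ) (b : Fin d → ℂ) (z : Cd d) : ℂ := b₀ + ∑ j, b j * z j

/-- On the unit ball `F` is the quotient of a `ℂ^d`-valued affine function by the affine function
with coefficients `b₀, b`, which has no zero in the closed unit ball. -/
def HasDenominator (F : Cd d → Cd d) (b₀ : ℂ) (b : Fin d → ℂ) : Prop :=
  (∀ z ∈ closedBall (0 : Cd d) 1, affineForm b₀ b z ≠ 0) ∧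
    ∃ (a₀ : Cd d) (a : Fin d → Cd d), ∀ z ∈ unitBall d,
      F z = (affineForm b₀ b z)⁻¹ • (a₀ + ∑ j, z j • a j)

end BallSuperresolution

end

open scoped Pointwise

noncomputable section

namespace BallSuperresolution

variable {d : ℕ}

/-! On the sphere `‖F‖ = 1` and `‖f‖ ≤ 1`, so `D = F - f` satisfies `‖D‖² ≤ 2 Re ⟨F, D⟩`.
Multiplying by `|b|²`, which is bounded below, replaces the right side by `2 Re ⟨N, b D⟩`, where `N
= b F` is affine. Homogeneous components of different degrees are orthogonal on the sphere, so the
integral of `⟨N, b D⟩` sees only the affine Taylor part of `b D`. That part depends only on `b` and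
the affine Taylor part of `D`. Hence `‖D‖²` is at most a constant times `ρ`, with `|b|` entering
through its bounds only; this is `sphereL2Norm_sq_le`. The stated inequality is weaker, since
`√(d(d+1)) ≥ 1`.

Boundary values come from Fatou's theorem: a bounded holomorphic function on the disc has a
Lipschitz primitive, differentiable almost everywhere along the circle, and such differentiability
passes to a radial limit of the derivative. Slicing the ball by complex lines and applying Fubini to
the circle action transfers this to the sphere. That automorphisms have affine denominators follows
from the explicit ball involutions and the Schwarz lemma. -/

/-! ### Fatou's theorem on the disc -/

/-- A maximum principle on the disc with one exceptional boundary point. -/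
lemma norm_le_of_norm_le_on_circle_diff {u : ℂ → ℂ} {B ε : ℝ} (hε : 0 < ε)
    (hc : ContinuousOn u (closedBall 0 1 \ {1})) (hd : DifferentiableOn ℂ u (ball 0 1))
    (hB : ∀ z ∈ closedBall (0 : ℂ) 1 \ {1}, ‖u z‖ ≤ B)
    (hs : ∀ z ∈ sphere (0 : ℂ) 1 \ {1}, ‖u z‖ ≤ ε) {z : ℂ} (hz : z ∈ ball (0 : ℂ) 1) :
    ‖u z‖ ≤ ε := by
  -- The factor `1 - w` kills the exceptional point, and taking `n`-th powers of `u` makes its cost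
  -- negligible as `n → ∞`.
  have key : ∀ n : ℕ, ‖u z‖ ^ n * ‖1 - z‖ ≤ 2 * ε ^ n := by
    intro n
    set Φ : ℂ → ℂ := fun w => u w ^ n * (1 - w) with hΦ
    have hB0 : 0 ≤ B := (norm_nonneg _).trans
      (hB 0 ⟨by simp, by simp⟩)
    have hcont : ContinuousOn Φ (closedBall 0 1) := by
      intro w hw
      by_cases h1 : w = 1
      · subst h1
        have h0 : Φ 1 = 0 := by simp [hΦ]
        rw [ContinuousWithinAt, h0]
        refine squeeze_zero_norm' (a := fun w => B ^ n * ‖1 - w‖) ?_ ?_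
        · filter_upwards [self_mem_nhdsWithin] with w hw
          by_cases h1 : w = 1
          · simp [h1, hΦ]
          · rw [hΦ, norm_mul, norm_pow]
            gcongr
            exact hB w ⟨hw, h1⟩
        · have : Tendsto (fun w : ℂ => B ^ n * ‖1 - w‖) (𝓝 1) (𝓝 (B ^ n * ‖(1 : ℂ) - 1‖)) :=
            Continuous.tendsto (by fun_prop) 1
          simpa using this.mono_left nhdsWithin_le_nhds
      · have h2 : ContinuousWithinAt u (closedBall 0 1) w :=
          (hc w ⟨hw, h1⟩).mono_of_mem_nhdsWithin
            (inter_mem_nhdsWithin _ (isOpen_compl_singleton.mem_nhds h1))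
        exact (h2.pow n).mul (by fun_prop)
    have hdiff : DiffContOnCl ℂ Φ (ball 0 1) := by
      refine ⟨(hd.pow n).mul (by fun_prop), ?_⟩
      rwa [closure_ball _ one_ne_zero]
    have := Complex.norm_le_of_forall_mem_frontier_norm_le isBounded_ball hdiff (C := 2 * ε ^ n)
      (fun w hw => by
        rw [frontier_ball _ one_ne_zero] at hw
        by_cases h1 : w = 1
        · simp [h1, hΦ]; positivity
        · have h2 : ‖(1 : ℂ) - w‖ ≤ 2 := by
            refine (norm_sub_le _ _).trans ?_
            rw [mem_sphere_zero_iff_norm.1 hw]; norm_num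
          rw [hΦ, norm_mul, norm_pow, mul_comm 2]
          gcongr
          exact hs w ⟨hw, h1⟩) (subset_closure hz)
    simpa [hΦ] using this
  by_contra! hlt
  have h1 : z ≠ 1 := by rintro rfl; simp at hz
  have hpos : 0 < ‖1 - z‖ := norm_pos_iff.2 (sub_ne_zero.2 h1.symm)
  obtain ⟨n, hn⟩ := pow_unbounded_of_one_lt (2 / ‖1 - z‖) ((one_lt_div hε).2 hlt)
  have := key n
  rw [div_pow, div_lt_div_iff₀ hpos (by positivity)] at hn
  linarith

/-- The multiplier `η / (η + 1 - z)` has modulus at most `1` on the disc and at most `η / δ` at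
distance `δ` from `1`. It therefore damps `u` on the far part of the circle, where only the bound
`B` is known, while within `η` of `1` it costs a factor of at most `2`. -/
lemma tendsto_zero_of_tendsto_circle {u : ℂ → ℂ} {B : ℝ}
    (hc : ContinuousOn u (closedBall 0 1 \ {1})) (hd : DifferentiableOn ℂ u (ball 0 1))
    (hB : ∀ z ∈ closedBall (0 : ℂ) 1 \ {1}, ‖u z‖ ≤ B)
    (hl : Tendsto u (𝓝[sphere 0 1 \ {1}] 1) (𝓝 0)) : Tendsto u (𝓝[ball 0 1] 1) (𝓝 0) := by
  rw [Metric.tendsto_nhdsWithin_nhds] at hl ⊢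
  intro ε hε
  obtain ⟨δ, hδ, hδ'⟩ := hl (ε / 3) (by positivity)
  have hB0 : 0 ≤ B := (norm_nonneg _).trans (hB 0 ⟨by simp, by simp⟩)
  set η : ℝ := ε / 3 * δ / (B + 1) with hη
  have hη0 : 0 < η := by positivity
  have hden : ∀ z ∈ closedBall (0 : ℂ) 1, η ≤ ‖(η : ℂ) + (1 - z)‖ ∧
      ‖1 - z‖ ≤ ‖(η : ℂ) + (1 - z)‖ := by
    intro z hz
    have hre : z.re ≤ 1 := (Complex.re_le_norm z).trans (by simpa using hz)
    constructor
    · refine le_trans ?_ (Complex.re_le_norm _)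
      simp; linarith
    · rw [Complex.norm_def, Complex.norm_def]
      apply Real.sqrt_le_sqrt
      simp [Complex.normSq_apply]
      nlinarith
  set G : ℂ → ℂ := fun z => u z * (η / (η + (1 - z))) with hG
  have hne : ∀ z ∈ closedBall (0 : ℂ) 1, (η : ℂ) + (1 - z) ≠ 0 := fun z hz =>
    norm_pos_iff.1 (hη0.trans_le (hden z hz).1)
  have hηn : ‖(η : ℂ)‖ = η := by simp [abs_of_pos hη0]
  have hm1 : ∀ z ∈ closedBall (0 : ℂ) 1, ‖(η : ℂ) / (η + (1 - z))‖ ≤ 1 := fun z hz => by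
    rw [norm_div, hηn]
    exact div_le_one_of_le₀ (hden z hz).1 (norm_nonneg _)
  have hGb : ∀ z ∈ ball (0 : ℂ) 1, ‖G z‖ ≤ ε / 3 := fun z hz => by
    refine norm_le_of_norm_le_on_circle_diff (u := G) (B := B) (by positivity) ?_ ?_ ?_ ?_ hz
    · exact hc.mul (ContinuousOn.div (by fun_prop) (by fun_prop) fun z hz => hne z hz.1)
    · exact hd.mul (DifferentiableOn.div (by fun_prop) (by fun_prop)
        fun z hz => hne z (ball_subset_closedBall hz))
    · intro w hw
      rw [hG, norm_mul]
      exact (mul_le_mul (hB w hw) (hm1 w hw.1) (norm_nonneg _) hB0).trans_eq (mul_one _)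
    · intro w hw
      have hw' : w ∈ closedBall (0 : ℂ) 1 := sphere_subset_closedBall hw.1
      rw [hG, norm_mul]
      by_cases h : dist w 1 < δ
      · have := hδ' hw h
        rw [dist_zero_right] at this
        exact (mul_le_mul this.le (hm1 w hw') (norm_nonneg _) (by positivity)).trans_eq (mul_one _)
      · rw [dist_comm, dist_eq_norm, not_lt] at h
        have h2 : δ ≤ ‖(η : ℂ) + (1 - w)‖ := h.trans (hden w hw').2
        rw [norm_div, hηn]
        calc ‖u w‖ * (η / ‖(η : ℂ) + (1 - w)‖) ≤ B * (η / δ) := by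
              gcongr
              exact hB w ⟨hw', hw.2⟩
          _ = B / (B + 1) * (ε / 3) := by rw [hη]; field_simp
          _ ≤ 1 * (ε / 3) := by
              gcongr
              exact div_le_one_of_le₀ (by linarith) (by linarith)
          _ = ε / 3 := one_mul _
  refine ⟨η, hη0, fun z hz hzη => ?_⟩
  have hz' := ball_subset_closedBall hz
  rw [dist_zero_right]
  have huz : u z = G z * ((η + (1 - z)) / η) := by
    have := hne z hz'
    have h2 : (η : ℂ) ≠ 0 := by exact_mod_cast hη0.ne'
    rw [hG]; field_simp
  rw [dist_comm, dist_eq_norm] at hzη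
  have hle : ‖((η : ℂ) + (1 - z)) / η‖ ≤ 2 := by
    rw [norm_div, hηn, div_le_iff₀ hη0]
    refine (norm_add_le _ _).trans ?_
    rw [hηn]; linarith
  rw [huz, norm_mul]
  calc _ ≤ ε / 3 * 2 := mul_le_mul (hGb z hz) hle (norm_nonneg _) (by positivity)
    _ < ε := by linarith

/-- If `H` is Lipschitz, holomorphic in the disc, and differentiable along the circle at `1`, then
its derivative has a radial limit at `1`. -/
lemma tendsto_deriv_of_differentiableAt_circle {H f : ℂ → ℂ} {K : NNReal} (hK : LipschitzWith K H)
    (hf : ∀ z ∈ ball (0 : ℂ) 1, HasDerivAt H (f z) z)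
    (hD : DifferentiableAt ℝ (fun θ : ℝ => H (Complex.exp (θ * Complex.I))) 0) :
    ∃ w, Tendsto (fun r : ℝ => f r) (𝓝[<] 1) (𝓝 w) := by
  obtain ⟨D, hD⟩ : ∃ D, HasDerivAt (fun θ : ℝ => H (Complex.exp (θ * Complex.I))) D 0 :=
    ⟨_, hD.hasDerivAt⟩
  -- The curve `e^{iθ}` has velocity `i` at `θ = 0`, so `L` is the candidate complex derivative of
  -- `H` at `1`.
  set L : ℂ := D / Complex.I with hL
  set u : ℂ → ℂ := fun z => (H z - H 1) / (z - 1) - L with hu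
  have hu0 : Tendsto u (𝓝[ball 0 1] 1) (𝓝 0) := by
    refine tendsto_zero_of_tendsto_circle (B := K + ‖L‖) ?_ ?_ ?_ ?_
    · refine ContinuousOn.sub (ContinuousOn.div ?_ (by fun_prop) ?_) continuousOn_const
      · exact (hK.continuous.sub continuous_const).continuousOn
      · intro z hz; exact sub_ne_zero.2 hz.2
    · refine DifferentiableOn.sub (DifferentiableOn.div ?_ (by fun_prop) ?_) (by fun_prop)
      · exact fun z hz => ((hf z hz).differentiableAt.sub_const _).differentiableWithinAt
      · rintro z hz h
        rw [sub_eq_zero] at h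
        simp [h] at hz
    · intro z hz
      refine (norm_sub_le _ _).trans ?_
      gcongr
      rw [norm_div]
      refine div_le_of_le_mul₀ (norm_nonneg _) K.2 ?_
      simpa [dist_eq_norm] using hK.dist_le_mul z 1
    · have h1 := hasDerivAt_iff_tendsto_slope.1 hD
      have hexp : HasDerivAt (fun θ : ℝ => Complex.exp (θ * Complex.I)) Complex.I 0 := by
        have h := ((Complex.ofRealCLM.hasDerivAt (x := (0 : ℝ))).mul_const Complex.I).cexp
        simpa using h
      have h2 := hasDerivAt_iff_tendsto_slope.1 hexp
      have h3 := (h1.div h2 Complex.I_ne_zero).sub_const L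
      rw [← hL, sub_self] at h3
      have harg : Tendsto Complex.arg (𝓝[sphere 0 1 \ {1}] 1) (𝓝[≠] 0) := by
        refine tendsto_nhdsWithin_iff.2 ⟨?_, ?_⟩
        · have := (Complex.continuousAt_arg (x := 1) (by simp)).tendsto
          rw [Complex.arg_one] at this
          exact this.mono_left nhdsWithin_le_nhds
        · filter_upwards [self_mem_nhdsWithin] with z hz h
          have h1 := Complex.norm_mul_exp_arg_mul_I z
          rw [mem_singleton_iff.1 h, mem_sphere_zero_iff_norm.1 hz.1] at h1
          exact hz.2 (by simpa using h1.symm)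
      refine (h3.comp harg).congr' ?_
      filter_upwards [self_mem_nhdsWithin] with z hz
      have h1 := Complex.norm_mul_exp_arg_mul_I z
      rw [mem_sphere_zero_iff_norm.1 hz.1, Complex.ofReal_one, one_mul] at h1
      have ha : (z.arg : ℂ) ≠ 0 := by
        intro h
        rw [h] at h1
        exact hz.2 (by simpa using h1.symm)
      have hz1 : z - 1 ≠ 0 := sub_ne_zero.2 hz.2
      simp only [Function.comp, slope_def_module, hu, Pi.div_apply, h1]
      simp only [sub_zero, Complex.ofReal_zero, zero_mul, Complex.exp_zero, Complex.real_smul,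
        Complex.ofReal_inv]
      field_simp
  refine ⟨L, ?_⟩
  rw [Metric.tendsto_nhdsWithin_nhds] at hu0 ⊢
  intro ε hε
  obtain ⟨δ, hδ, hδ'⟩ := hu0 (ε / 4) (by positivity)
  refine ⟨min (δ / 2) 1, by positivity, fun r hr hr' => ?_⟩
  simp only [mem_Iio] at hr
  rw [Real.dist_eq, abs_of_neg (by linarith)] at hr'
  have hr1 : 1 - r < δ / 2 := by have := hr'.trans_le (min_le_left _ _); linarith
  have hr0 : 0 < r := by have := hr'.trans_le (min_le_right _ _); linarith
  set e : ℂ → ℂ := fun z => H z - H 1 - L * (z - 1) with he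
  have hball : closedBall (r : ℂ) ((1 - r) / 2) ⊆ ball (0 : ℂ) 1 := by
    intro z hz
    rw [mem_closedBall, dist_eq_norm] at hz
    rw [mem_ball_zero_iff]
    calc ‖z‖ = ‖(z - r) + r‖ := by simp
      _ ≤ ‖z - r‖ + ‖(r : ℂ)‖ := norm_add_le _ _
      _ < 1 := by rw [Complex.norm_real, Real.norm_of_nonneg hr0.le]; linarith
  have hed : ∀ z ∈ ball (0 : ℂ) 1, HasDerivAt e (f z - L) z := fun z hz => by
    have h := ((hf z hz).sub_const (H 1)).sub (((hasDerivAt_id z).sub_const 1).const_mul L)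
    rw [mul_one] at h
    exact h
  have hrb : (r : ℂ) ∈ ball (0 : ℂ) 1 := hball (mem_closedBall_self (by linarith))
  -- Cauchy's estimate on the disc of radius `(1 - r) / 2` about `r`: there `e = u * (z - 1)` is
  -- small compared with `1 - r`, so `e' = f - L` is small at `r`.
  have hmain : ‖deriv e r‖ ≤ (ε / 4 * (3 / 2 * (1 - r))) / ((1 - r) / 2) := by
    refine Complex.norm_deriv_le_of_forall_mem_sphere_norm_le (by linarith) ?_ ?_
    · refine DifferentiableOn.diffContOnCl (fun z hz => ?_)
      rw [closure_ball _ (by linarith)] at hz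
      exact (hed z (hball hz)).differentiableAt.differentiableWithinAt
    · intro z hz
      have hzb := hball (sphere_subset_closedBall hz)
      rw [mem_sphere, dist_eq_norm] at hz
      have hz1 : ‖z - 1‖ ≤ 3 / 2 * (1 - r) := by
        calc ‖z - 1‖ = ‖(z - r) - ((1 - r : ℝ) : ℂ)‖ := by push_cast; ring_nf
          _ ≤ ‖z - r‖ + ‖((1 - r : ℝ) : ℂ)‖ := norm_sub_le _ _
          _ = _ := by rw [hz, Complex.norm_real, Real.norm_of_nonneg (by linarith)]; ring
      have hne : z - 1 ≠ 0 := by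
        intro h; rw [sub_eq_zero] at h; simp [h] at hzb
      have hez : e z = u z * (z - 1) := by
        simp only [he, hu]; field_simp
      have := hδ' hzb (by rw [dist_eq_norm]; linarith)
      rw [dist_zero_right] at this
      rw [hez, norm_mul]
      exact mul_le_mul this.le hz1 (norm_nonneg _) (by positivity)
  rw [(hed r hrb).deriv] at hmain
  rw [dist_eq_norm]
  have h1r : (1 - r) ≠ 0 := by linarith
  have : ε / 4 * (3 / 2 * (1 - r)) / ((1 - r) / 2) = 3 / 4 * ε := by field_simp
  linarith

/-- **Fatou's theorem** on the unit disc. -/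
theorem ae_exists_radial_limit {f : ℂ → ℂ} {M : ℝ} (hd : DifferentiableOn ℂ f (ball 0 1))
    (hM : ∀ z ∈ ball (0 : ℂ) 1, ‖f z‖ ≤ M) :
    ∀ᵐ θ : ℝ, ∃ w, Tendsto (fun r : ℝ => f (r * Complex.exp (θ * Complex.I))) (𝓝[<] 1) (𝓝 w) := by
  obtain ⟨h, hh⟩ := hd.isExactOn_ball
  have hM0 : 0 ≤ M := (norm_nonneg _).trans (hM 0 (by simp))
  lift M to NNReal using hM0
  have hlip : LipschitzOnWith M h (ball 0 1) :=
    (convex_ball (0 : ℂ) 1).lipschitzOnWith_of_nnnorm_hasDerivWithin_le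
      (fun z hz => (hh z hz).hasDerivWithinAt) (fun z hz => hM z hz)
  obtain ⟨H, hHl, hHeq⟩ := hlip.extend_finite_dimension
  set K := lipschitzExtensionConstant ℂ * M
  have hHd : ∀ z ∈ ball (0 : ℂ) 1, HasDerivAt H (f z) z := fun z hz =>
    (hh z hz).congr_of_eventuallyEq (hHeq.symm.eventuallyEq_of_mem (isOpen_ball.mem_nhds hz))
  have hexp : LipschitzWith 1 (fun θ : ℝ => Complex.exp (θ * Complex.I)) := by
    have hder : ∀ θ : ℝ, HasDerivAt (fun θ : ℝ => Complex.exp (θ * Complex.I))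
        (Complex.exp (θ * Complex.I) * Complex.I) θ := fun θ => by
      simpa using ((Complex.ofRealCLM.hasDerivAt (x := θ)).mul_const Complex.I).cexp
    refine lipschitzWith_of_nnnorm_deriv_le (fun θ => (hder θ).differentiableAt) fun θ => ?_
    rw [(hder θ).deriv, ← NNReal.coe_le_coe]
    simp
  -- Rademacher's theorem for the Lipschitz function `θ ↦ H (e^{iθ})`; each good point `ζ` is then
  -- rotated to `1`.
  filter_upwards [(hHl.comp hexp).ae_differentiableAt] with θ hθ
  set ζ := Complex.exp (θ * Complex.I) with hζ
  have hζn : ‖ζ‖ = 1 := Complex.norm_exp_ofReal_mul_I θ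
  have hζ0 : ζ ≠ 0 := Complex.exp_ne_zero _
  obtain ⟨w, hw⟩ := tendsto_deriv_of_differentiableAt_circle (H := fun z => H (ζ * z))
    (f := fun z => f (ζ * z) * ζ) (K := K)
    (by
      have : LipschitzWith 1 (fun z : ℂ => ζ * z) := LipschitzWith.of_dist_le_mul fun x y => by
        rw [dist_eq_norm, dist_eq_norm, ← mul_sub, norm_mul, hζn]; simp
      have h := hHl.comp this
      rw [mul_one] at h
      exact h)
    (fun z hz => by
      have h1 := hHd (ζ * z) (by simpa [hζn] using hz)
      have h := h1.comp z ((hasDerivAt_id z).const_mul ζ)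
      rw [mul_one] at h
      exact h)
    (by
      have h1 : DifferentiableAt ℝ (fun t : ℝ => θ + t) 0 := by fun_prop
      have h2 := DifferentiableAt.comp (0 : ℝ) (by simpa using hθ) h1
      refine h2.congr_of_eventuallyEq (.of_forall fun t => ?_)
      simp [hζ, ← Complex.exp_add, add_mul])
  refine ⟨w * ζ⁻¹, (hw.mul_const ζ⁻¹).congr fun r => ?_⟩
  rw [mul_assoc, mul_inv_cancel₀ hζ0, mul_one, mul_comm]

/-! ### The circle action on the sphere -/

instance : IsFiniteMeasure (surfaceMeasure d) := by
  unfold surfaceMeasure; infer_instance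

/-- The action of `e^{iθ}` on the sphere. -/
def rotate (θ : ℝ) (ξ : UnitSphere d) : UnitSphere d :=
  ⟨Complex.exp (θ * Complex.I) • (ξ : Cd d), by
    rw [mem_sphere_zero_iff_norm, norm_smul, Complex.norm_exp_ofReal_mul_I, one_mul,
      mem_sphere_zero_iff_norm.1 ξ.2]⟩

lemma coe_rotate (θ : ℝ) (ξ : UnitSphere d) :
    (rotate θ ξ : Cd d) = Complex.exp (θ * Complex.I) • (ξ : Cd d) := rfl

lemma continuous_rotate : Continuous fun p : UnitSphere d × ℝ => rotate p.2 p.1 := by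
  unfold rotate; fun_prop

lemma rotate_neg_rotate (θ : ℝ) (ξ : UnitSphere d) : rotate (-θ) (rotate θ ξ) = ξ := by
  ext1
  rw [coe_rotate, coe_rotate, smul_smul, ← Complex.exp_add]
  simp

lemma rotate_rotate_neg (θ : ℝ) (ξ : UnitSphere d) : rotate θ (rotate (-θ) ξ) = ξ := by
  simpa using rotate_neg_rotate (-θ) ξ

/-- The surface measure of `s` is a multiple of the volume of the cone over `s`, and multiplication
by `e^{iθ}` is a real linear isometry that carries cones to cones. -/
lemma measurePreserving_rotate (θ : ℝ) :
    MeasurePreserving (rotate θ) (surfaceMeasure d) (surfaceMeasure d) := by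
  have hm : Measurable (rotate (d := d) θ) :=
    (continuous_rotate.comp (continuous_id.prodMk continuous_const)).measurable
  refine ⟨hm, Measure.ext fun s hs => ?_⟩
  set c := Complex.exp (θ * Complex.I) with hc
  let U : Cd d ≃ₗᵢ[ℝ] Cd d :=
    { toLinearEquiv := (LinearEquiv.smulOfNeZero ℂ (Cd d) c (Complex.exp_ne_zero _)).restrictScalars ℝ
      norm_map' := fun x => by
        change ‖c • x‖ = ‖x‖
        rw [norm_smul, hc, Complex.norm_exp_ofReal_mul_I, one_mul] }
  have hU : ∀ x, U x = c • x := fun x => rfl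
  rw [Measure.map_apply hm hs, surfaceMeasure, Measure.toSphere_apply' _ (hm hs),
    Measure.toSphere_apply' _ hs]
  congr 1
  have hset : Ioo (0 : ℝ) 1 • ((↑) '' (rotate θ ⁻¹' s) : Set (Cd d)) =
      U ⁻¹' (Ioo (0 : ℝ) 1 • ((↑) '' s : Set (Cd d))) := by
    ext x
    simp only [Set.mem_smul, mem_image, mem_preimage]
    constructor
    · rintro ⟨t, ht, _, ⟨ξ, hξ, rfl⟩, rfl⟩
      exact ⟨t, ht, _, ⟨_, hξ, rfl⟩, by rw [map_smul, hU, coe_rotate]⟩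
    · rintro ⟨t, ht, _, ⟨ξ, hξ, rfl⟩, hx⟩
      refine ⟨t, ht, _, ⟨rotate (-θ) ξ, by rw [rotate_rotate_neg]; exact hξ, rfl⟩, U.injective ?_⟩
      rw [← hx, map_smul, hU, ← coe_rotate, rotate_rotate_neg]
  rw [hset]
  exact (U.measurePreserving).measure_preimage_equiv
    (f := U.toHomeomorph.toMeasurableEquiv) _

/-- By Fubini some single `θ` has `p (rotate θ ξ)` for almost every `ξ`; rotating back by `-θ`
preserves null sets. -/
lemma ae_of_forall_ae_rotate {p : UnitSphere d → Prop} (hp : MeasurableSet {ξ | p ξ})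
    (h : ∀ ξ, ∀ᵐ θ : ℝ, p (rotate θ ξ)) : ∀ᵐ ξ ∂surfaceMeasure d, p ξ := by
  have h1 : ∀ᵐ ξ ∂surfaceMeasure d, ∀ᵐ θ : ℝ, p (rotate θ ξ) := .of_forall h
  rw [Measure.ae_ae_comm (p := fun ξ θ => p (rotate θ ξ))
    (continuous_rotate.measurable hp)] at h1
  obtain ⟨θ, hθ⟩ := h1.exists
  have := (measurePreserving_rotate (d := d) (-θ)).quasiMeasurePreserving.ae hθ
  simpa only [rotate_rotate_neg] using this

lemma integrable_of_continuous {E : Type*} [NormedAddCommGroup E]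
    [SecondCountableTopology E] {k : UnitSphere d → E}
    (hk : Continuous k) : Integrable k (surfaceMeasure d) := by
  obtain ⟨C, hC⟩ := (isCompact_range hk).isBounded.exists_norm_le
  exact .of_bound hk.aestronglyMeasurable C (.of_forall fun ξ => hC _ (mem_range_self ξ))

lemma integral_eq_integral_average {k : UnitSphere d → ℂ} (hk : Continuous k) :
    ∫ ξ, k ξ ∂surfaceMeasure d =
      ∫ ξ, ((2 * Real.pi)⁻¹ • ∫ θ in (0 : ℝ)..2 * Real.pi, k (rotate θ ξ)) ∂surfaceMeasure d := by
  have hpi : (0 : ℝ) ≤ 2 * Real.pi := by positivity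
  obtain ⟨C, hC⟩ := (isCompact_range hk).isBounded.exists_norm_le
  simp_rw [intervalIntegral.integral_of_le hpi]
  rw [integral_smul, integral_integral_swap]
  · have : ∀ θ : ℝ, ∫ ξ, k (rotate θ ξ) ∂surfaceMeasure d = ∫ ξ, k ξ ∂surfaceMeasure d :=
      fun θ => by
        have hmp := measurePreserving_rotate (d := d) θ
        conv_rhs => rw [← hmp.map_eq]
        rw [integral_map hmp.measurable.aemeasurable hk.aestronglyMeasurable]
    simp_rw [this]
    rw [integral_const, measureReal_restrict_apply_univ, Real.volume_real_Ioc_of_le hpi, sub_zero,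
      smul_smul, inv_mul_cancel₀ (by positivity), one_smul]
  · refine .of_bound (C := C) ?_ (.of_forall fun p => hC _ (mem_range_self _))
    exact (hk.comp continuous_rotate).aestronglyMeasurable

/-! ### Radial boundary values on the sphere -/

lemma smul_sphere_mem_unitBall {r : ℝ} (hr : r ∈ Ioo (0 : ℝ) 1) (ξ : UnitSphere d) :
    r • (ξ : Cd d) ∈ unitBall d := by
  rw [unitBall, mem_ball_zero_iff, norm_smul, mem_sphere_zero_iff_norm.1 ξ.2, mul_one,
    Real.norm_of_nonneg hr.1.le]
  exact hr.2

lemma smul_sphere_mem_unitBall' {ζ : ℂ} (hζ : ζ ∈ ball (0 : ℂ) 1) (ξ : UnitSphere d) :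
    ζ • (ξ : Cd d) ∈ unitBall d := by
  rw [unitBall, mem_ball_zero_iff, norm_smul, mem_sphere_zero_iff_norm.1 ξ.2, mul_one]
  exact mem_ball_zero_iff.1 hζ

lemma eventually_mem_Ioo : ∀ᶠ r : ℝ in 𝓝[<] 1, r ∈ Ioo (0 : ℝ) 1 :=
  Ioo_mem_nhdsLT zero_lt_one

/-- Restricting to countably many radii makes the set of points with a radial limit measurable, as
Fubini requires. -/
lemma tendsto_nhdsLT_of_tendsto_rat {E : Type*} [PseudoMetricSpace E] {g : ℝ → E} {c : E}
    (hg : ContinuousOn g (Ioo 0 1))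
    (h : Tendsto (fun q : {q : ℚ // (q : ℝ) ∈ Ioo (0 : ℝ) 1} => g q)
      (comap (fun q : {q : ℚ // (q : ℝ) ∈ Ioo (0 : ℝ) 1} => (q : ℝ)) (𝓝[<] 1)) (𝓝 c)) :
    Tendsto g (𝓝[<] 1) (𝓝 c) := by
  rw [Metric.tendsto_nhds] at h ⊢
  intro ε hε
  obtain ⟨s, hs, hs'⟩ := mem_comap.1 (h (ε / 2) (by positivity))
  obtain ⟨l, hl, hl'⟩ := (mem_nhdsLT_iff_exists_Ioo_subset' (zero_lt_one' ℝ)).1 hs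
  filter_upwards [eventually_mem_Ioo, Ioo_mem_nhdsLT hl] with r hr hr'
  refine lt_of_le_of_lt (?_ : dist (g r) c ≤ ε / 2) (by linarith)
  by_contra! hlt
  have hca : ContinuousAt g r := hg.continuousAt (isOpen_Ioo.mem_nhds hr)
  have hev : ∀ᶠ t in 𝓝 r, ε / 2 < dist (g t) c :=
    (hca.dist continuousAt_const).eventually (lt_mem_nhds hlt)
  have h0 : ∀ᶠ t in 𝓝 r, t ∈ Ioo (0 : ℝ) 1 := Ioo_mem_nhds hr.1 hr.2
  have hl : ∀ᶠ t in 𝓝 r, t ∈ Ioo l 1 := Ioo_mem_nhds hr'.1 hr'.2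
  obtain ⟨u, hu, huo, hru⟩ := _root_.eventually_nhds_iff.1 (hev.and (h0.and hl))
  obtain ⟨q, hqu⟩ := (Rat.denseRange_cast (𝕜 := ℝ)).exists_mem_open huo ⟨r, hru⟩
  have h1 : dist (g q) c < ε / 2 :=
    hs' (show (⟨q, (hu _ hqu).2.1⟩ : {q : ℚ // (q : ℝ) ∈ Ioo (0 : ℝ) 1}) ∈ _ from
      hl' (hu _ hqu).2.2)
  exact lt_asymm h1 (hu _ hqu).1

/-- Bounded holomorphic maps of the ball have radial limits almost everywhere. -/
lemma ae_exists_hasRadialLimit {f : Cd d → Cd d} (hf : IsHolomorphicSelfMap f) :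
    ∀ᵐ ξ ∂surfaceMeasure d, ∃ w, HasRadialLimit f ξ w := by
  refine ae_of_forall_ae_rotate ?_ fun ξ => ?_
  · have hm := StronglyMeasurable.measurableSet_exists_tendsto
      (l := comap (fun q : {q : ℚ // (q : ℝ) ∈ Ioo (0 : ℝ) 1} => (q : ℝ)) (𝓝[<] 1))
      (f := fun (q : {q : ℚ // (q : ℝ) ∈ Ioo (0 : ℝ) 1}) (ξ : UnitSphere d) => f ((q : ℝ) • (ξ : Cd d)))
      (fun q => Continuous.stronglyMeasurable
        (hf.1.continuousOn.comp_continuous (by fun_prop) fun ξ => smul_sphere_mem_unitBall q.2 ξ))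
    convert hm using 3 with ξ
    refine exists_congr fun w => ⟨fun h => h.comp tendsto_comap, fun h => ?_⟩
    refine tendsto_nhdsLT_of_tendsto_rat (g := fun r => f (r • (ξ : Cd d))) ?_ h
    exact hf.1.continuousOn.comp (by fun_prop) fun r hr => smul_sphere_mem_unitBall hr ξ
  -- Each coordinate of `ζ ↦ f (ζ • ξ)` is a bounded holomorphic function on the disc.
  · have hj : ∀ j : Fin d, ∀ᵐ θ : ℝ, ∃ w, Tendsto
        (fun r : ℝ => f ((r * Complex.exp (θ * Complex.I)) • (ξ : Cd d)) j) (𝓝[<] 1) (𝓝 w) := by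
      intro j
      refine ae_exists_radial_limit (f := fun ζ => f (ζ • (ξ : Cd d)) j) (M := 1) ?_ ?_
      · have h1 : DifferentiableOn ℂ (fun ζ : ℂ => f (ζ • (ξ : Cd d))) (ball 0 1) :=
          hf.1.comp (by fun_prop) fun ζ hζ => smul_sphere_mem_unitBall' hζ ξ
        exact (EuclideanSpace.proj j : Cd d →L[ℂ] ℂ).differentiable.comp_differentiableOn h1
      · intro ζ hζ
        refine (PiLp.norm_apply_le _ j).trans (mem_ball_zero_iff.1 ?_).le
        exact hf.2 (smul_sphere_mem_unitBall' hζ ξ)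
    filter_upwards [ae_all_iff.2 hj] with θ hθ
    choose w hw using hθ
    refine ⟨WithLp.toLp 2 w, ?_⟩
    have h1 := (PiLp.continuous_toLp 2 (fun _ : Fin d => ℂ)).continuousAt.tendsto.comp
      (tendsto_pi_nhds.2 hw)
    refine h1.congr fun r => ?_
    simp only [Function.comp_apply, coe_rotate, mul_smul, Complex.coe_smul]

lemma HasRadialLimit.boundaryValue_eq {f : Cd d → Cd d} {ξ : UnitSphere d} {w : Cd d}
    (h : HasRadialLimit f ξ w) : boundaryValue f ξ = w := Tendsto.limUnder_eq h

lemma IsHolomorphicSelfMap.ae_hasRadialLimit {f : Cd d → Cd d} (hf : IsHolomorphicSelfMap f) :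
    ∀ᵐ ξ ∂surfaceMeasure d, HasRadialLimit f ξ (boundaryValue f ξ) := by
  filter_upwards [ae_exists_hasRadialLimit hf] with ξ ⟨w, hw⟩
  rwa [hw.boundaryValue_eq]

lemma IsHolomorphicSelfMap.norm_le {f : Cd d → Cd d} (hf : IsHolomorphicSelfMap f)
    {z : Cd d} (hz : z ∈ unitBall d) : ‖f z‖ ≤ 1 := (mem_ball_zero_iff.1 (hf.2 hz)).le

lemma HasRadialLimit.norm_le {f : Cd d → Cd d} {ξ : UnitSphere d} {w : Cd d}
    (h : HasRadialLimit f ξ w) (hf : IsHolomorphicSelfMap f) : ‖w‖ ≤ 1 :=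
  le_of_tendsto (Tendsto.norm h) (eventually_mem_Ioo.mono fun _ hr =>
    hf.norm_le (smul_sphere_mem_unitBall hr ξ))

lemma continuous_comp_smul_sphere {f : Cd d → Cd d} (hf : DifferentiableOn ℂ f (unitBall d))
    {r : ℝ} (hr : r ∈ Ioo (0 : ℝ) 1) : Continuous fun ξ : UnitSphere d => f (r • (ξ : Cd d)) :=
  hf.continuousOn.comp_continuous (by fun_prop) fun ξ => smul_sphere_mem_unitBall hr ξ

lemma exists_seq_Ioo_tendsto :
    ∃ r : ℕ → ℝ, (∀ n, r n ∈ Ioo (0 : ℝ) 1) ∧ Tendsto r atTop (𝓝[<] 1) := by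
  obtain ⟨r, -, hr, hr'⟩ := exists_seq_strictMono_tendsto' (zero_lt_one' ℝ)
  exact ⟨r, hr, tendsto_nhdsWithin_iff.2 ⟨hr', .of_forall fun n => (hr n).2⟩⟩

lemma IsHolomorphicSelfMap.hasBoundedBoundaryValues {f : Cd d → Cd d}
    (hf : IsHolomorphicSelfMap f) : HasBoundedBoundaryValues f := by
  refine ⟨ae_exists_hasRadialLimit hf, memLp_top_of_bound (C := 1) ?_ ?_⟩
  · obtain ⟨r, hr, hr'⟩ := exists_seq_Ioo_tendsto
    refine aestronglyMeasurable_of_tendsto_ae atTop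
      (f := fun n (ξ : UnitSphere d) => f (r n • (ξ : Cd d))) (fun n => ?_) ?_
    · exact (continuous_comp_smul_sphere hf.1 (hr n)).aestronglyMeasurable
    · filter_upwards [hf.ae_hasRadialLimit] with ξ hξ
      exact Tendsto.comp (f := r) (g := fun t : ℝ => f (t • (ξ : Cd d))) hξ hr'
  · filter_upwards [hf.ae_hasRadialLimit] with ξ hξ using hξ.norm_le hf

/-! ### Pairing affine maps with holomorphic maps -/

lemma circleAverage_inv_mul_eq_deriv {ψ : ℂ → ℂ} (h : DifferentiableOn ℂ ψ (closedBall 0 1)) :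
    Real.circleAverage (fun z => z⁻¹ * ψ z) 0 1 = deriv ψ 0 := by
  rw [Real.circleAverage_eq_circleIntegral one_ne_zero]
  have h1 := h.deriv_eq_smul_circleIntegral zero_lt_one
  have h2 : (∮ z in C(0, 1), (z - 0)⁻¹ • (z⁻¹ * ψ z)) = ∮ z in C(0, 1), (1 / (z - 0) ^ 2) • ψ z := by
    congr 1
    funext z
    simp only [sub_zero, smul_eq_mul, one_div, pow_two, mul_inv]
    ring
  rw [h2, h1, smul_smul, inv_mul_cancel₀ Complex.two_pi_I_ne_zero, one_smul]

/-- The inner product is conjugate-linear in its first slot and `conj z = z⁻¹` on the circle. So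
`N₀` picks out the mean value of `φ`, and `N₁` its first Taylor coefficient. -/
lemma circleAverage_inner_affine {φ : ℂ → Cd d} (hφ : DifferentiableOn ℂ φ (closedBall 0 1))
    (N₀ N₁ φ' : Cd d) (hφ' : HasDerivAt φ φ' 0) :
    Real.circleAverage (fun z => inner ℂ (N₀ + z • N₁) (φ z)) 0 1 =
      inner ℂ N₀ (φ 0) + inner ℂ N₁ φ' := by
  have hd : ∀ N : Cd d, DifferentiableOn ℂ (fun z => inner ℂ N (φ z)) (closedBall 0 1) :=
    fun N => (innerSL ℂ N).differentiable.comp_differentiableOn hφ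
  have hderiv : deriv (fun z => inner ℂ N₁ (φ z)) 0 = inner ℂ N₁ φ' :=
    ((innerSL ℂ N₁).hasFDerivAt.comp_hasDerivAt (0 : ℂ) hφ').deriv
  have h1 : Real.circleAverage (fun z => inner ℂ N₀ (φ z)) 0 1 = inner ℂ N₀ (φ 0) := by
    refine DiffContOnCl.circleAverage (DifferentiableOn.diffContOnCl ?_)
    rw [abs_one, closure_ball _ one_ne_zero]
    exact hd N₀
  rw [← h1, ← hderiv, ← circleAverage_inv_mul_eq_deriv (hd N₁), ← Real.circleAverage_fun_add]
  · refine Real.circleAverage_congr_sphere fun z hz => ?_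
    rw [abs_one, mem_sphere_zero_iff_norm] at hz
    simp only [inner_add_left, inner_smul_left, ← Complex.inv_eq_conj hz]
  · refine ContinuousOn.circleIntegrable zero_le_one ((hd N₀).continuousOn.mono sphere_subset_closedBall)
  · refine ContinuousOn.circleIntegrable zero_le_one (ContinuousOn.mul ?_
      ((hd N₁).continuousOn.mono sphere_subset_closedBall))
    refine continuousOn_inv₀.mono fun z hz h0 => ?_
    rw [mem_singleton_iff.1 h0] at hz
    simp at hz

/-- Averaging over the orbits `e^{iθ} ξ` reduces this to the slice `z ↦ g (r z ξ)`. Taking `r < 1`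
keeps the closed disc of the slice inside the ball, so no boundary values enter. -/
lemma integral_inner_affine (N₀ : Cd d) (N₁ : Cd d →L[ℂ] Cd d) {g : Cd d → Cd d}
    (hg : DifferentiableOn ℂ g (unitBall d)) {r : ℝ} (hr : r ∈ Ioo (0 : ℝ) 1) :
    ∫ ξ : UnitSphere d, inner ℂ (N₀ + N₁ ξ) (g (r • (ξ : Cd d))) ∂surfaceMeasure d =
      ∫ ξ : UnitSphere d, (inner ℂ N₀ (g 0) + inner ℂ (N₁ ξ) (r • fderiv ℂ g 0 ξ))
        ∂surfaceMeasure d := by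
  rw [integral_eq_integral_average]
  · congr 1
    funext ξ
    have hb : ∀ z ∈ closedBall (0 : ℂ) 1, (r * z) • (ξ : Cd d) ∈ unitBall d := fun z hz => by
      refine smul_sphere_mem_unitBall' ?_ ξ
      rw [mem_closedBall_zero_iff] at hz
      rw [mem_ball_zero_iff, norm_mul, Complex.norm_real, Real.norm_of_nonneg hr.1.le]
      nlinarith [hr.1, hr.2]
    have hopen : IsOpen (unitBall d) := isOpen_ball
    have hφ : DifferentiableOn ℂ (fun z : ℂ => g ((r * z) • (ξ : Cd d))) (closedBall 0 1) :=
      hg.comp (by fun_prop) hb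
    have h0 : DifferentiableAt ℂ g ((((r : ℂ) * 0)) • (ξ : Cd d)) :=
      hg.differentiableAt (hopen.mem_nhds (hb 0 (by simp)))
    have hφ' : HasDerivAt (fun z : ℂ => g ((r * z) • (ξ : Cd d))) (r • fderiv ℂ g 0 ξ) 0 := by
      have h1 : HasDerivAt (fun z : ℂ => (r * z) • (ξ : Cd d)) ((r : ℂ) • (ξ : Cd d)) 0 := by
        simpa using (((hasDerivAt_id (0 : ℂ)).const_mul (r : ℂ)).smul_const (ξ : Cd d))
      have h2 := h0.hasFDerivAt.comp_hasDerivAt (0 : ℂ) h1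
      rw [mul_zero, zero_smul, map_smul, Complex.coe_smul] at h2
      exact h2
    have := circleAverage_inner_affine hφ N₀ (N₁ ξ) _ hφ'
    rw [mul_zero, zero_smul] at this
    rw [← this, Real.circleAverage_def]
    congr 1
    refine intervalIntegral.integral_congr fun θ _ => ?_
    simp only [coe_rotate, circleMap_zero, Complex.ofReal_one, one_mul, map_smul, mul_smul,
      Complex.coe_smul]
  · exact Continuous.inner (by fun_prop) (continuous_comp_smul_sphere hg hr)

/-! ### The L² estimate -/

/-- If `w` were interior, continuity of the inverse `G` at `w` would give `G w = lim r ξ = ξ`, which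
is not in the open ball. -/
lemma IsBallAutomorphism.norm_eq_one {F : Cd d → Cd d} (hF : IsBallAutomorphism F)
    {ξ : UnitSphere d} {w : Cd d} (h : HasRadialLimit F ξ w) : ‖w‖ = 1 := by
  refine le_antisymm (h.norm_le hF.1) ?_
  by_contra! hlt
  obtain ⟨hF, G, hG, hGF, -⟩ := hF
  have hw : w ∈ unitBall d := mem_ball_zero_iff.2 hlt
  have hopen : IsOpen (unitBall d) := isOpen_ball
  have h1 : Tendsto (fun r : ℝ => G (F (r • (ξ : Cd d)))) (𝓝[<] 1) (𝓝 (G w)) :=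
    (hG.1.continuousOn.continuousAt (hopen.mem_nhds hw)).tendsto.comp h
  have h2 : Tendsto (fun r : ℝ => r • (ξ : Cd d)) (𝓝[<] 1) (𝓝 ((1 : ℝ) • (ξ : Cd d))) :=
    (Continuous.tendsto (by fun_prop) 1).mono_left nhdsWithin_le_nhds
  have h3 : G w = (1 : ℝ) • (ξ : Cd d) := tendsto_nhds_unique (h1.congr' (by
    filter_upwards [eventually_mem_Ioo] with r hr using hGF (smul_sphere_mem_unitBall hr ξ))) h2
  have h4 := mem_ball_zero_iff.1 (hG.2 hw)
  rw [h3, one_smul, mem_sphere_zero_iff_norm.1 ξ.2] at h4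
  exact lt_irrefl _ h4

lemma sphereL2Norm_sq {g : UnitSphere d → Cd d} (hg : MemLp g 2 (surfaceMeasure d)) :
    sphereL2Norm g ^ 2 = ∫ ξ, ‖g ξ‖ ^ 2 ∂surfaceMeasure d := by
  have h0 : 0 ≤ ∫ ξ, ‖g ξ‖ ^ 2 ∂surfaceMeasure d := integral_nonneg fun ξ => by positivity
  rw [sphereL2Norm, hg.eLpNorm_eq_integral_rpow_norm (by norm_num) (by norm_num),
    ENNReal.toReal_ofReal (by positivity)]
  simp only [ENNReal.toReal_ofNat, Real.rpow_ofNat]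
  rw [← Real.rpow_natCast, ← Real.rpow_mul h0]
  norm_num

lemma integral_norm_le_mul_sphereL2Norm {g : UnitSphere d → Cd d}
    (hg : MemLp g 2 (surfaceMeasure d)) :
    ∫ ξ, ‖g ξ‖ ∂surfaceMeasure d ≤
      √((surfaceMeasure d).real univ) * sphereL2Norm g := by
  have h1 : MemLp g 1 (surfaceMeasure d) := hg.mono_exponent (by norm_num)
  have h := eLpNorm_le_eLpNorm_mul_rpow_measure_univ (μ := surfaceMeasure d) (p := 1) (q := 2)
    (by norm_num) hg.1
  have hexp : (1 / (1 : ENNReal).toReal - 1 / (2 : ENNReal).toReal) = 1 / 2 := by norm_num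
  rw [hexp] at h
  have hfin : surfaceMeasure d univ ^ (1 / 2 : ℝ) ≠ ⊤ :=
    ENNReal.rpow_ne_top_of_nonneg (by norm_num) (measure_ne_top _ _)
  have h2 := ENNReal.toReal_mono (ENNReal.mul_ne_top hg.2.ne hfin) h
  rwa [eLpNorm_one_eq_lintegral_enorm, ← integral_norm_eq_lintegral_enorm h1.1, ENNReal.toReal_mul,
    ← ENNReal.toReal_rpow, ← Real.sqrt_eq_rpow, mul_comm] at h2

/-- The antipodal map is the rotation by `π`, and `2 p` is the sum of the values of `p + A` at `ξ`
and `-ξ`. -/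
lemma integral_norm_const_le_integral_norm_affine (p : Cd d) (A : Cd d →L[ℂ] Cd d) :
    ∫ _ : UnitSphere d, ‖p‖ ∂surfaceMeasure d ≤
      ∫ ξ : UnitSphere d, ‖p + A ξ‖ ∂surfaceMeasure d := by
  have hc : Continuous fun ξ : UnitSphere d => ‖p + A ξ‖ := by fun_prop
  have hmp := measurePreserving_rotate (d := d) Real.pi
  have hrot : ∫ ξ : UnitSphere d, ‖p + A (rotate Real.pi ξ)‖ ∂surfaceMeasure d =
      ∫ ξ : UnitSphere d, ‖p + A ξ‖ ∂surfaceMeasure d := by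
    conv_rhs => rw [← hmp.map_eq]
    rw [integral_map hmp.measurable.aemeasurable hc.aestronglyMeasurable]
  have hc' : Continuous fun ξ : UnitSphere d => ‖p + A (rotate Real.pi ξ)‖ :=
    hc.comp (continuous_rotate.comp (continuous_id.prodMk continuous_const))
  have hle : ∫ _ : UnitSphere d, 2 * ‖p‖ ∂surfaceMeasure d ≤
      ∫ ξ : UnitSphere d, (‖p + A ξ‖ + ‖p + A (rotate Real.pi ξ)‖) ∂surfaceMeasure d := by
    refine integral_mono (integrable_const _)
      ((integrable_of_continuous hc).add (integrable_of_continuous hc')) fun ξ => ?_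
    calc 2 * ‖p‖ = ‖(p + A ξ) + (p + A (rotate Real.pi ξ))‖ := by
          rw [coe_rotate, Complex.exp_pi_mul_I, neg_one_smul, map_neg]
          rw [show p + A ξ + (p + -A ξ) = (2 : ℝ) • p by module, norm_smul]
          simp
      _ ≤ _ := norm_add_le _ _
  rw [integral_add (integrable_of_continuous hc) (integrable_of_continuous hc'), hrot,
    integral_const_mul] at hle
  linarith

lemma norm_le_of_norm_add_le {E : Type*} [NormedAddCommGroup E] [NormedSpace ℂ E] {p q : E} {M : ℝ}
    (h : ‖p + q‖ ≤ M) (h' : ‖p - q‖ ≤ M) : ‖p‖ ≤ M ∧ ‖q‖ ≤ M := by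
  constructor
  · have : 2 * ‖p‖ ≤ ‖p + q‖ + ‖p - q‖ := by
      calc 2 * ‖p‖ = ‖(p + q) + (p - q)‖ := by
            rw [show p + q + (p - q) = (2 : ℂ) • p by module, norm_smul]; simp
        _ ≤ _ := norm_add_le _ _
    linarith
  · have : 2 * ‖q‖ ≤ ‖p + q‖ + ‖p - q‖ := by
      calc 2 * ‖q‖ = ‖(p + q) - (p - q)‖ := by
            rw [show p + q - (p - q) = (2 : ℂ) • q by module, norm_smul]; simp
        _ ≤ _ := norm_sub_le _ _
    linarith

/-- Pairing `b h` with an affine map only sees the first-order Taylor polynomial of `h`. -/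
lemma norm_integral_inner_affine_le {N₀ : Cd d} {N₁ : Cd d →L[ℂ] Cd d} {b₀ : ℂ}
    {b₁ : Cd d →L[ℂ] ℂ} {M : ℝ} (hb : ∀ ξ : UnitSphere d, ‖b₀ + b₁ ξ‖ ≤ M)
    (hN : ∀ ξ : UnitSphere d, ‖N₀ + N₁ ξ‖ ≤ M) {h : Cd d → Cd d}
    (hh : DifferentiableOn ℂ h (unitBall d)) {r : ℝ} (hr : r ∈ Ioo (0 : ℝ) 1) :
    ‖∫ ξ : UnitSphere d, inner ℂ (N₀ + N₁ ξ)
        ((b₀ + b₁ (r • (ξ : Cd d))) • h (r • (ξ : Cd d))) ∂surfaceMeasure d‖ ≤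
      4 * M ^ 2 * ∫ ξ : UnitSphere d, ‖h 0 + fderiv ℂ h 0 ξ‖ ∂surfaceMeasure d := by
  have hopen : IsOpen (unitBall d) := isOpen_ball
  have h0 : DifferentiableAt ℂ h 0 :=
    hh.differentiableAt (hopen.mem_nhds (mem_ball_self zero_lt_one))
  have hb₁ : Differentiable ℂ fun z => b₀ + b₁ z := by fun_prop
  have hfd : ∀ v, fderiv ℂ (fun z => (b₀ + b₁ z) • h z) 0 v = b₀ • fderiv ℂ h 0 v + b₁ v • h 0 := by
    intro v
    have h1 : HasFDerivAt (fun z => b₀ + b₁ z) b₁ 0 := b₁.hasFDerivAt.const_add b₀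
    have h2 := (h1.smul h0.hasFDerivAt).fderiv
    have h3 := congrArg (fun L : Cd d →L[ℂ] Cd d => L v) h2
    simp only [map_zero, add_zero] at h3
    exact h3
  rw [integral_inner_affine N₀ N₁ (g := fun z => (b₀ + b₁ z) • h z)
    (hb₁.differentiableOn.smul hh) hr]
  set A := fderiv ℂ h 0
  simp only [hfd, map_zero, add_zero]
  have hint : Integrable (fun ξ : UnitSphere d => ‖h 0 + A ξ‖) (surfaceMeasure d) :=
    integrable_of_continuous (by fun_prop)
  have hb' : ∀ ξ : UnitSphere d, ‖b₀‖ ≤ M ∧ ‖b₁ ξ‖ ≤ M := fun ξ => by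
    refine norm_le_of_norm_add_le (hb ξ) ?_
    simpa [sub_eq_add_neg] using hb (-ξ)
  have hN' : ∀ ξ : UnitSphere d, ‖N₀‖ ≤ M ∧ ‖N₁ ξ‖ ≤ M := fun ξ => by
    refine norm_le_of_norm_add_le (hN ξ) ?_
    simpa [sub_eq_add_neg] using hN (-ξ)
  -- The linear part of the product is `b₀ A ξ + b₁ ξ • h 0`. Writing `A ξ = (h 0 + A ξ) - h 0`
  -- gives three terms in `‖h 0‖` and one in `‖h 0 + A ξ‖`; the antipodal inequality absorbs the
  -- former, whence the factor `4`.
  calc _ ≤ ∫ ξ : UnitSphere d, (3 * M ^ 2 * ‖h 0‖ + M ^ 2 * ‖h 0 + A ξ‖) ∂surfaceMeasure d := by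
        refine norm_integral_le_of_norm_le
          ((integrable_const _).add (hint.const_mul _)) (.of_forall fun ξ => ?_)
        obtain ⟨hb0, hb1⟩ := hb' ξ
        obtain ⟨hN0, hN1⟩ := hN' ξ
        have hM : 0 ≤ M := (norm_nonneg _).trans hb0
        have hA : ‖A ξ‖ ≤ ‖h 0 + A ξ‖ + ‖h 0‖ := by
          simpa using norm_sub_le (h 0 + A ξ) (h 0)
        have e1 : ‖(inner ℂ N₀ (b₀ • h 0) : ℂ)‖ ≤ M * (M * ‖h 0‖) := by
          refine (norm_inner_le_norm _ _).trans ?_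
          rw [norm_smul]
          gcongr
        have e2 : ‖(inner ℂ (N₁ ξ) (r • (b₀ • A ξ + b₁ ξ • h 0)) : ℂ)‖ ≤
            M * (M * (‖h 0 + A ξ‖ + ‖h 0‖) + M * ‖h 0‖) := by
          refine (norm_inner_le_norm _ _).trans ?_
          have e3 : ‖r • (b₀ • A ξ + b₁ ξ • h 0)‖ ≤ ‖b₀ • A ξ + b₁ ξ • h 0‖ := by
            rw [norm_smul, Real.norm_of_nonneg hr.1.le]
            exact mul_le_of_le_one_left (norm_nonneg _) hr.2.le
          have e4 := e3.trans (norm_add_le _ _)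
          rw [norm_smul b₀, norm_smul (b₁ ξ)] at e4
          refine mul_le_mul hN1 (e4.trans ?_) (norm_nonneg _) hM
          gcongr
        refine (norm_add_le _ _).trans ((add_le_add e1 e2).trans_eq ?_)
        ring
    _ = 3 * M ^ 2 * ∫ _ : UnitSphere d, ‖h 0‖ ∂surfaceMeasure d +
        M ^ 2 * ∫ ξ : UnitSphere d, ‖h 0 + A ξ‖ ∂surfaceMeasure d := by
        rw [integral_add (integrable_const _) (hint.const_mul _), integral_const_mul,
          integral_const_mul]
    _ ≤ 3 * M ^ 2 * ∫ ξ : UnitSphere d, ‖h 0 + A ξ‖ ∂surfaceMeasure d +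
        M ^ 2 * ∫ ξ : UnitSphere d, ‖h 0 + A ξ‖ ∂surfaceMeasure d := by
        gcongr ?_ + _
        exact mul_le_mul_of_nonneg_left (integral_norm_const_le_integral_norm_affine _ _)
          (by positivity)
    _ = _ := by ring

/-- The bound on the sphere of radius `r` is uniform in `r`, so it survives `r → 1` by dominated
convergence. -/
lemma norm_integral_inner_boundary_le {N₀ : Cd d} {N₁ : Cd d →L[ℂ] Cd d} {b₀ : ℂ}
    {b₁ : Cd d →L[ℂ] ℂ} {M : ℝ} (hb : ∀ ξ : UnitSphere d, ‖b₀ + b₁ ξ‖ ≤ M)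
    (hN : ∀ ξ : UnitSphere d, ‖N₀ + N₁ ξ‖ ≤ M) {h : Cd d → Cd d}
    (hh : DifferentiableOn ℂ h (unitBall d)) {B : ℝ} (hB : ∀ z ∈ unitBall d, ‖h z‖ ≤ B)
    {w : UnitSphere d → Cd d} (hw : ∀ᵐ ξ ∂surfaceMeasure d, HasRadialLimit h ξ (w ξ)) :
    ‖∫ ξ : UnitSphere d, inner ℂ (N₀ + N₁ ξ) ((b₀ + b₁ ξ) • w ξ) ∂surfaceMeasure d‖ ≤
      4 * M ^ 2 * ∫ ξ : UnitSphere d, ‖h 0 + fderiv ℂ h 0 ξ‖ ∂surfaceMeasure d := by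
  obtain ⟨r, hr, hr'⟩ := exists_seq_Ioo_tendsto
  have hlim := tendsto_integral_of_dominated_convergence
    (F := fun n (ξ : UnitSphere d) => (inner ℂ (N₀ + N₁ ξ)
        ((b₀ + b₁ (r n • (ξ : Cd d))) • h (r n • (ξ : Cd d))) : ℂ))
    (f := fun ξ => inner ℂ (N₀ + N₁ ξ) ((b₀ + b₁ ξ) • w ξ)) (μ := surfaceMeasure d)
    (fun _ => M * ((‖b₀‖ + ‖b₁‖) * B)) ?_ (integrable_const _) ?_ ?_
  · exact le_of_tendsto hlim.norm (.of_forall fun n => norm_integral_inner_affine_le hb hN hh (hr n))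
  · intro n
    have hc := continuous_comp_smul_sphere hh (hr n)
    have hc1 : Continuous fun ξ : UnitSphere d => N₀ + N₁ ξ := by fun_prop
    have hc2 : Continuous fun ξ : UnitSphere d => b₀ + b₁ (r n • (ξ : Cd d)) := by fun_prop
    exact hc1.aestronglyMeasurable.inner (hc2.smul hc).aestronglyMeasurable
  · refine fun n => .of_forall fun ξ => (norm_inner_le_norm _ _).trans ?_
    have hM : 0 ≤ M := (norm_nonneg _).trans (hb ξ)
    have hmem := smul_sphere_mem_unitBall (hr n) ξ
    rw [norm_smul]
    gcongr
    · exact hN ξ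
    · refine (norm_add_le _ _).trans ?_
      gcongr
      exact b₁.le_of_opNorm_le_of_le le_rfl (mem_ball_zero_iff.1 hmem).le |>.trans_eq (mul_one _)
    · exact hB _ hmem
  · filter_upwards [hw] with ξ hξ
    have h1 : Tendsto (fun n => h (r n • (ξ : Cd d))) atTop (𝓝 (w ξ)) :=
      Tendsto.comp (f := r) (g := fun t : ℝ => h (t • (ξ : Cd d))) hξ hr'
    have h2 : Tendsto (fun n => b₀ + b₁ (r n • (ξ : Cd d))) atTop (𝓝 (b₀ + b₁ ξ)) := by
      have h3 : Tendsto (fun t : ℝ => b₀ + b₁ (t • (ξ : Cd d))) (𝓝[<] 1)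
          (𝓝 (b₀ + b₁ ((1 : ℝ) • (ξ : Cd d)))) :=
        (Continuous.tendsto (by fun_prop) 1).mono_left nhdsWithin_le_nhds
      rw [one_smul] at h3
      exact h3.comp hr'
    exact tendsto_const_nhds.inner (h2.smul h1)

/-- The core estimate: a pointwise lower bound for `Re ⟨b F, b D⟩` against the integral bound above,
then Cauchy–Schwarz to pass from the `L¹` to the `L²` norm of the Taylor difference. The bound `M`
on `b` also bounds the numerator, because `‖F‖ = 1` on the sphere. -/
lemma sphereL2Norm_sq_le {F f : Cd d → Cd d} (hF : IsBallAutomorphism F)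
    (hf : IsHolomorphicSelfMap f) {N₀ : Cd d} {N₁ : Cd d →L[ℂ] Cd d} {b₀ : ℂ}
    {b₁ : Cd d →L[ℂ] ℂ} {M m : ℝ} (hm : 0 < m) (hb : ∀ ξ : UnitSphere d, ‖b₀ + b₁ ξ‖ ≤ M)
    (hbm : ∀ z ∈ closedBall (0 : Cd d) 1, m ≤ ‖b₀ + b₁ z‖)
    (hFb : ∀ z ∈ unitBall d, F z = (b₀ + b₁ z)⁻¹ • (N₀ + N₁ z)) :
    sphereL2Norm (fun ξ => boundaryValue F ξ - boundaryValue f ξ) ^ 2 ≤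
      8 * M ^ 2 * √((surfaceMeasure d).real univ) / m ^ 2 *
        sphereL2Norm (fun ξ => affineTaylor F ξ - affineTaylor f ξ) := by
  have hne : ∀ ξ : UnitSphere d, b₀ + b₁ ξ ≠ 0 := fun ξ =>
    norm_pos_iff.1 (hm.trans_le (hbm ξ (sphere_subset_closedBall ξ.2)))
  have hFlim : ∀ ξ : UnitSphere d, HasRadialLimit F ξ ((b₀ + b₁ ξ)⁻¹ • (N₀ + N₁ ξ)) := fun ξ => by
    have h1 : ContinuousAt (fun t : ℝ => (b₀ + b₁ (t • (ξ : Cd d)))⁻¹ • (N₀ + N₁ (t • (ξ : Cd d)))) 1 := by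
      have hc1 : Continuous fun t : ℝ => b₀ + b₁ (t • (ξ : Cd d)) := by fun_prop
      have hc2 : Continuous fun t : ℝ => N₀ + N₁ (t • (ξ : Cd d)) := by fun_prop
      refine (hc1.continuousAt.inv₀ ?_).smul hc2.continuousAt
      rw [one_smul]; exact hne ξ
    have h2 := h1.tendsto.mono_left (nhdsWithin_le_nhds (s := Iio 1))
    rw [one_smul] at h2
    refine h2.congr' ?_
    filter_upwards [eventually_mem_Ioo] with r hr
    rw [hFb _ (smul_sphere_mem_unitBall hr ξ)]
  have hbv : ∀ ξ, boundaryValue F ξ = (b₀ + b₁ ξ)⁻¹ • (N₀ + N₁ ξ) := fun ξ =>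
    (hFlim ξ).boundaryValue_eq
  have hbv1 : ∀ ξ : UnitSphere d, ‖boundaryValue F ξ‖ = 1 := fun ξ => by
    rw [hbv]; exact hF.norm_eq_one (hFlim ξ)
  have hNb : ∀ ξ : UnitSphere d, N₀ + N₁ ξ = (b₀ + b₁ ξ) • boundaryValue F ξ := fun ξ => by
    rw [hbv, smul_smul, mul_inv_cancel₀ (hne ξ), one_smul]
  have hN : ∀ ξ : UnitSphere d, ‖N₀ + N₁ ξ‖ ≤ M := fun ξ => by
    rw [hNb, norm_smul, hbv1, mul_one]; exact hb ξ
  set D : UnitSphere d → Cd d := fun ξ => boundaryValue F ξ - boundaryValue f ξ with hD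
  have hDtop : MemLp D ⊤ (surfaceMeasure d) :=
    hF.1.hasBoundedBoundaryValues.2.sub hf.hasBoundedBoundaryValues.2
  have hD2 : MemLp D 2 (surfaceMeasure d) := hDtop.mono_exponent le_top
  have hopen : IsOpen (unitBall d) := isOpen_ball
  have h0b : unitBall d ∈ 𝓝 (0 : Cd d) := hopen.mem_nhds (mem_ball_self zero_lt_one)
  have hT : ∀ ξ, affineTaylor F ξ - affineTaylor f ξ =
      (F - f) 0 + fderiv ℂ (F - f) 0 ξ := fun ξ => by
    rw [fderiv_sub (hF.1.1.differentiableAt h0b) (hf.1.differentiableAt h0b)]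
    simp only [affineTaylor, Pi.sub_apply, sub_apply]
    abel
  have hTL : MemLp (fun ξ : UnitSphere d => (F - f) 0 + fderiv ℂ (F - f) 0 ξ) 2
      (surfaceMeasure d) := by
    have hc : Continuous fun ξ : UnitSphere d => (F - f) 0 + fderiv ℂ (F - f) 0 ξ := by fun_prop
    obtain ⟨C, hC⟩ := (isCompact_range hc).isBounded.exists_norm_le
    exact .of_bound hc.aestronglyMeasurable C (.of_forall fun ξ => hC _ (mem_range_self ξ))
  have hpair := norm_integral_inner_boundary_le hb hN (h := F - f) (hF.1.1.sub hf.1) (B := 2)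
    (fun z hz => (norm_sub_le _ _).trans
      ((add_le_add (hF.1.norm_le hz) (hf.norm_le hz)).trans_eq one_add_one_eq_two)) (w := D) (by
        filter_upwards [hF.1.ae_hasRadialLimit, hf.ae_hasRadialLimit] with ξ h1 h2
        exact Tendsto.sub h1 h2)
  have hDint : Integrable (fun ξ => ‖D ξ‖ ^ 2) (surfaceMeasure d) := hD2.integrable_norm_pow (by norm_num)
  have hIint : Integrable (fun ξ : UnitSphere d => (inner ℂ (N₀ + N₁ ξ) ((b₀ + b₁ ξ) • D ξ) : ℂ))
      (surfaceMeasure d) := by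
    refine .of_bound (C := M * (M * 2)) ?_ ?_
    · have hc1 : Continuous fun ξ : UnitSphere d => N₀ + N₁ ξ := by fun_prop
      have hc2 : Continuous fun ξ : UnitSphere d => b₀ + b₁ ξ := by fun_prop
      exact hc1.aestronglyMeasurable.inner (hc2.aestronglyMeasurable.smul hD2.1)
    · filter_upwards [hf.ae_hasRadialLimit] with ξ hξ
      have hM : 0 ≤ M := (norm_nonneg _).trans (hb ξ)
      refine (norm_inner_le_norm _ _).trans ?_
      rw [norm_smul]
      gcongr
      · exact hN ξ
      · exact hb ξ
      · exact (norm_sub_le _ _).trans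
          ((add_le_add (hbv1 ξ).le (hξ.norm_le hf)).trans_eq one_add_one_eq_two)
  have hmain : ∫ ξ, m ^ 2 * ‖D ξ‖ ^ 2 ∂surfaceMeasure d ≤
      ∫ ξ : UnitSphere d, 2 * (inner ℂ (N₀ + N₁ ξ) ((b₀ + b₁ ξ) • D ξ) : ℂ).re
        ∂surfaceMeasure d := by
    refine integral_mono_ae (hDint.const_mul _) (hIint.re.const_mul 2) ?_
    filter_upwards [hf.ae_hasRadialLimit] with ξ hξ
    -- Expanding the square with `‖F‖ = 1` turns this into `‖D‖² ≤ 2 Re ⟨F, D⟩`.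
    have h1 : ‖boundaryValue F ξ - D ξ‖ ^ 2 ≤ 1 := by
      have : boundaryValue F ξ - D ξ = boundaryValue f ξ := by simp [hD]
      rw [this]
      exact pow_le_one₀ (norm_nonneg _) (hξ.norm_le hf)
    rw [@norm_sub_sq ℂ, hbv1] at h1
    have h2 : (inner ℂ (N₀ + N₁ ξ) ((b₀ + b₁ ξ) • D ξ) : ℂ).re =
        ‖b₀ + b₁ ξ‖ ^ 2 * (inner ℂ (boundaryValue F ξ) (D ξ) : ℂ).re := by
      rw [hNb, inner_smul_left, inner_smul_right, ← mul_assoc, Complex.conj_mul']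
      rw [← Complex.ofReal_pow, Complex.re_ofReal_mul]
    have h3 : m ^ 2 ≤ ‖b₀ + b₁ ξ‖ ^ 2 := by
      gcongr
      exact hbm ξ (sphere_subset_closedBall ξ.2)
    simp only [RCLike.re_to_complex] at h1
    rw [h2]
    calc m ^ 2 * ‖D ξ‖ ^ 2 ≤ ‖b₀ + b₁ ξ‖ ^ 2 * (2 * (inner ℂ (boundaryValue F ξ) (D ξ) : ℂ).re) := by
          gcongr
          linarith
      _ = _ := by ring
  rw [integral_const_mul, integral_const_mul, ← sphereL2Norm_sq hD2] at hmain
  have hre : ∫ ξ : UnitSphere d, (inner ℂ (N₀ + N₁ ξ) ((b₀ + b₁ ξ) • D ξ) : ℂ).re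
      ∂surfaceMeasure d = (∫ ξ : UnitSphere d, (inner ℂ (N₀ + N₁ ξ) ((b₀ + b₁ ξ) • D ξ) : ℂ)
      ∂surfaceMeasure d).re := integral_re hIint
  have h5 := (Complex.re_le_norm _).trans hpair
  have h6 := integral_norm_le_mul_sphereL2Norm hTL
  rw [← hre] at h5
  simp only [hT]
  rw [div_mul_eq_mul_div, le_div_iff₀ (by positivity)]
  have h7 := mul_le_mul_of_nonneg_left h6 (by positivity : 0 ≤ 8 * M ^ 2)
  linarith

lemma exists_pos_le_norm {b : Cd d → ℂ} (hb : Continuous b)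
    (hne : ∀ z ∈ closedBall (0 : Cd d) 1, b z ≠ 0) :
    ∃ m > 0, ∀ z ∈ closedBall (0 : Cd d) 1, m ≤ ‖b z‖ := by
  obtain ⟨z, hz, hmin⟩ := (isCompact_closedBall (0 : Cd d) 1).exists_isMinOn
    (nonempty_closedBall.2 zero_le_one) hb.norm.continuousOn
  exact ⟨‖b z‖, norm_pos_iff.2 (hne z hz), fun w hw => hmin hw⟩

lemma exists_constant (b₀ : ℂ) (b : Fin d → ℂ) :
    ∃ C > 0, ∀ F f : Cd d → Cd d, IsBallAutomorphism F → HasDenominator F b₀ b →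
      IsHolomorphicSelfMap f →
      sphereL2Norm (fun ξ => boundaryValue F ξ - boundaryValue f ξ) ^ 2 ≤
        C * sphereL2Norm (fun ξ => affineTaylor F ξ - affineTaylor f ξ) := by
  by_cases hne : ∀ z ∈ closedBall (0 : Cd d) 1, affineForm b₀ b z ≠ 0
  swap
  -- Coefficients with a zero in the closed ball are no denominator, so any positive value serves.
  · exact ⟨1, one_pos, fun F f _ h => absurd h.1 hne⟩
  set b₁ : Cd d →L[ℂ] ℂ := ∑ j, b j • (EuclideanSpace.proj j : Cd d →L[ℂ] ℂ) with hb₁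
  have haff : ∀ z, affineForm b₀ b z = b₀ + b₁ z := fun z => by
    simp [affineForm, hb₁]
  simp only [haff] at hne
  obtain ⟨m, hm, hbm⟩ := exists_pos_le_norm (b := fun z => b₀ + b₁ z) (by fun_prop) hne
  set M := ‖b₀‖ + ‖b₁‖
  have hbM : ∀ ξ : UnitSphere d, ‖b₀ + b₁ ξ‖ ≤ M := fun ξ => by
    refine (norm_add_le _ _).trans ?_
    have := b₁.le_opNorm ξ
    rw [mem_sphere_zero_iff_norm.1 ξ.2, mul_one] at this
    exact add_le_add le_rfl this
  refine ⟨8 * M ^ 2 * √((surfaceMeasure d).real univ) / m ^ 2 + 1, by positivity,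
    fun F f hF ⟨_, a₀, a, ha⟩ hf => ?_⟩
  refine (sphereL2Norm_sq_le hF hf (N₀ := a₀)
    (N₁ := ∑ j, (EuclideanSpace.proj j : Cd d →L[ℂ] ℂ).smulRight (a j)) hm hbM hbm
    fun z hz => ?_).trans ?_
  · rw [ha z hz, haff]
    simp
  · exact mul_le_mul_of_nonneg_right (by linarith) ENNReal.toReal_nonneg

/-! ### Automorphisms as quotients of affine maps -/

/-- The involutive automorphism of the ball exchanging `0` and `a`, where `s ^ 2 = 1 - ‖a‖ ^ 2`. -/
def ballInvolution (a : Cd d) (s : ℝ) (z : Cd d) : Cd d :=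
  (1 - inner ℂ a z)⁻¹ • ((1 - inner ℂ a z / (1 + s)) • a - (s : ℂ) • z)

lemma one_sub_inner_ne_zero {a z : Cd d} (ha : ‖a‖ < 1) (hz : ‖z‖ ≤ 1) :
    (1 : ℂ) - inner ℂ a z ≠ 0 := by
  intro h
  have h1 : ‖(inner ℂ a z : ℂ)‖ = 1 := by rw [← sub_eq_zero.1 h]; simp
  have h2 := norm_inner_le_norm (𝕜 := ℂ) a z
  nlinarith [norm_nonneg a, norm_nonneg z]

/-- Dividing by `‖1 - ⟨a, z⟩‖²` shows that the involution preserves the ball. The coefficient `1 /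
(1 + s)` stands for `(1 - s) / ‖a‖²`, equal to it when `a ≠ 0` and still meaningful at `a = 0`. -/
lemma norm_sq_ballInvolution_numerator {a : Cd d} {s : ℝ} (hs : 0 < s)
    (has : s ^ 2 = 1 - ‖a‖ ^ 2) (z : Cd d) :
    ‖(1 - inner ℂ a z / (1 + s)) • a - (s : ℂ) • z‖ ^ 2 =
      ‖(1 : ℂ) - inner ℂ a z‖ ^ 2 - s ^ 2 * (1 - ‖z‖ ^ 2) := by
  rw [@norm_sub_sq ℂ]
  have ha : ‖a‖ ^ 2 = 1 - s ^ 2 := by linarith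
  simp only [norm_smul, mul_pow, inner_smul_left, inner_smul_right, ha]
  set t : ℂ := inner ℂ a z
  have hk : t / (1 + s) = ((1 + s)⁻¹ : ℝ) * t := by push_cast; rw [div_eq_mul_inv, mul_comm]
  have hk1 : (1 + s)⁻¹ * (1 + s) = 1 := inv_mul_cancel₀ (by positivity)
  rw [hk]
  generalize (1 + s)⁻¹ = k at hk1
  simp only [← Complex.normSq_eq_norm_sq, Complex.normSq_apply, RCLike.re_to_complex, Complex.mul_re, Complex.mul_im,
    Complex.conj_re, Complex.conj_im, Complex.sub_re, Complex.sub_im, Complex.one_re,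
    Complex.one_im, Complex.ofReal_re, Complex.ofReal_im]
  linear_combination (-2 * t.re * (1 - s) + (t.re ^ 2 + t.im ^ 2) * k * (1 - s) +
    (t.re ^ 2 + t.im ^ 2)) * hk1

lemma isHolomorphicSelfMap_ballInvolution {a : Cd d} (ha : ‖a‖ < 1) {s : ℝ} (hs : 0 < s)
    (has : s ^ 2 = 1 - ‖a‖ ^ 2) : IsHolomorphicSelfMap (ballInvolution a s) := by
  have hin : Differentiable ℂ fun z : Cd d => inner ℂ a z := (innerSL ℂ a).differentiable
  refine ⟨?_, fun z hz => ?_⟩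
  · refine DifferentiableOn.smul (?_ : DifferentiableOn ℂ (fun z : Cd d =>
      ((1 : ℂ) - inner ℂ a z)⁻¹) (unitBall d)) ?_
    · exact (hin.const_sub 1).differentiableOn.inv fun z hz =>
        one_sub_inner_ne_zero ha (mem_ball_zero_iff.1 hz).le
    · have : Differentiable ℂ fun z : Cd d => (1 - inner ℂ a z / (1 + s)) • a - (s : ℂ) • z :=
        by fun_prop
      exact this.differentiableOn
  · have hz' : ‖z‖ < 1 := mem_ball_zero_iff.1 hz
    have hne := norm_pos_iff.2 (one_sub_inner_ne_zero ha hz'.le)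
    rw [unitBall, mem_ball_zero_iff, ballInvolution, norm_smul, norm_inv, inv_mul_lt_iff₀ hne,
      mul_one]
    refine lt_of_pow_lt_pow_left₀ 2 hne.le ?_
    rw [norm_sq_ballInvolution_numerator hs has]
    have : 0 < s ^ 2 * (1 - ‖z‖ ^ 2) := mul_pos (by positivity) (by nlinarith [norm_nonneg z])
    linarith

lemma ballInvolution_ballInvolution {a : Cd d} (ha : ‖a‖ < 1) {s : ℝ} (hs : 0 < s)
    (has : s ^ 2 = 1 - ‖a‖ ^ 2) {z : Cd d} (hz : ‖z‖ ≤ 1) :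
    ballInvolution a s (ballInvolution a s z) = z := by
  have hne := one_sub_inner_ne_zero ha hz
  have haa : (inner ℂ a a : ℂ) = 1 - (s : ℂ) ^ 2 := by
    rw [inner_self_eq_norm_sq_to_K]
    have : ‖a‖ ^ 2 = 1 - s ^ 2 := by linarith
    have h := congrArg (fun x : ℝ => (x : ℂ)) this
    simpa using h
  have hs1 : (1 + (s : ℂ)) ≠ 0 := by
    have : (1 + s) ≠ 0 := by positivity
    exact_mod_cast this
  have hs0 : (s : ℂ) ≠ 0 := by exact_mod_cast hs.ne'
  have hin : (inner ℂ a (ballInvolution a s z) : ℂ) =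
      (1 - inner ℂ a z)⁻¹ * (1 - (s : ℂ) ^ 2 - inner ℂ a z) := by
    rw [ballInvolution, inner_smul_right, inner_sub_right, inner_smul_right, inner_smul_right, haa]
    congr 1
    field_simp
    ring
  unfold ballInvolution at hin ⊢
  rw [hin]
  set t : ℂ := inner ℂ a z
  have hinv : (1 - (1 - t)⁻¹ * (1 - (s : ℂ) ^ 2 - t))⁻¹ = (1 - t) / (s : ℂ) ^ 2 := by
    have : 1 - (1 - t)⁻¹ * (1 - (s : ℂ) ^ 2 - t) = (s : ℂ) ^ 2 / (1 - t) := by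
      field_simp; ring
    rw [this, inv_div]
  rw [hinv]
  match_scalars
  · field_simp
    ring
  · field_simp

/-- An origin-preserving holomorphic map of the ball that preserves the norm is linear. -/
lemma eq_fderiv_of_norm_eq {K : Cd d → Cd d} (hK : DifferentiableOn ℂ K (unitBall d))
    (hn : ∀ z ∈ unitBall d, ‖K z‖ = ‖z‖) {z : Cd d} (hz : z ∈ unitBall d) :
    K z = fderiv ℂ K 0 z := by
  have h0b : (0 : Cd d) ∈ unitBall d := mem_ball_self zero_lt_one
  have hopen : IsOpen (unitBall d) := isOpen_ball
  have hK0 : K 0 = 0 := norm_eq_zero.1 (by rw [hn 0 h0b, norm_zero])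
  rcases eq_or_ne z 0 with rfl | hz0
  · simp [hK0]
  have hzn : ‖z‖ < 1 := mem_ball_zero_iff.1 hz
  have hzp : 0 < ‖z‖ := norm_pos_iff.2 hz0
  set φ : ℂ → Cd d := fun ζ => K (ζ • z) with hφ
  have hb : ∀ ζ ∈ ball (0 : ℂ) ‖z‖⁻¹, ζ • z ∈ unitBall d := fun ζ hζ => by
    rw [mem_ball_zero_iff] at hζ
    rw [unitBall, mem_ball_zero_iff, norm_smul]
    calc ‖ζ‖ * ‖z‖ < ‖z‖⁻¹ * ‖z‖ := by gcongr
      _ = 1 := inv_mul_cancel₀ hzp.ne'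
  have h1b : (1 : ℂ) ∈ ball (0 : ℂ) ‖z‖⁻¹ := by
    rw [mem_ball_zero_iff, norm_one]; exact (one_lt_inv₀ hzp).2 hzn
  have h0b' : (0 : ℂ) ∈ ball (0 : ℂ) ‖z‖⁻¹ := mem_ball_self (by positivity)
  have hφd : DifferentiableOn ℂ φ (ball 0 ‖z‖⁻¹) := hK.comp (by fun_prop) hb
  have hds : DifferentiableOn ℂ (dslope φ 0) (ball 0 ‖z‖⁻¹) :=
    (Complex.differentiableOn_dslope (isOpen_ball.mem_nhds h0b')).2 hφd
  have hφ0 : φ 0 = 0 := by simp [hφ, hK0]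
  have hnorm : ∀ ζ ∈ ball (0 : ℂ) ‖z‖⁻¹, ζ ≠ 0 → ‖dslope φ 0 ζ‖ = ‖z‖ := fun ζ hζ h => by
    rw [dslope_of_ne _ h, slope_def_module, hφ0, sub_zero, sub_zero, norm_smul, norm_inv, hφ,
      hn _ (hb ζ hζ), norm_smul, inv_mul_cancel_left₀ (norm_ne_zero_iff.2 h)]
  have hnorm0 : ‖dslope φ 0 0‖ = ‖z‖ := by
    have hc : ContinuousAt (dslope φ 0) 0 :=
      (hds.continuousOn).continuousAt (isOpen_ball.mem_nhds h0b')
    refine tendsto_nhds_unique (hc.norm.tendsto.mono_left nhdsWithin_le_nhds : Tendsto _ (𝓝[≠] (0 : ℂ)) _)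
      (tendsto_const_nhds.congr' ?_)
    filter_upwards [self_mem_nhdsWithin,
      nhdsWithin_le_nhds (isOpen_ball.mem_nhds h0b')] with ζ h1 h2 using (hnorm ζ h2 h1).symm
  -- The slope of the slice has constant norm `‖z‖`. The Euclidean norm is strictly convex, so the
  -- maximum principle makes the slope itself constant; its values at `1` and `0` are `K z` and
  -- `DK(0) z`. The point `1` is interior because `‖z‖⁻¹ > 1`.
  have heq := Complex.eqOn_of_isPreconnected_of_isMaxOn_norm (convex_ball (0 : ℂ) ‖z‖⁻¹).isPreconnected
    isOpen_ball hds h1b (fun ζ hζ => by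
      simp only [mem_ofPred_eq, Function.comp_apply, hnorm 1 h1b one_ne_zero]
      by_cases h : ζ = 0
      · rw [h, hnorm0]
      · exact (hnorm ζ hζ h).le) h0b'
  have hderiv : HasDerivAt φ (fderiv ℂ K 0 z) 0 := by
    have h1 : HasDerivAt (fun ζ : ℂ => ζ • z) z 0 := by
      simpa using (hasDerivAt_id (0 : ℂ)).smul_const z
    have h0 : DifferentiableAt ℂ K ((0 : ℂ) • z) := by
      rw [zero_smul]; exact hK.differentiableAt (hopen.mem_nhds h0b)
    have h2 := h0.hasFDerivAt.comp_hasDerivAt (0 : ℂ) h1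
    rw [zero_smul] at h2
    exact h2
  rw [dslope_same, hderiv.deriv, Function.const_apply, dslope_of_ne _ one_ne_zero,
    slope_def_module, hφ0] at heq
  rw [heq]
  simp [hφ]

lemma sum_smul_map_single (L : Cd d →ₗ[ℂ] Cd d) (z : Cd d) :
    ∑ j, z j • L (EuclideanSpace.single j 1) = L z := by
  conv_rhs => rw [← (EuclideanSpace.basisFun (Fin d) ℂ).sum_repr z]
  simp

/-- Every holomorphic automorphism of the ball is a quotient of affine functions. -/
theorem IsBallAutomorphism.exists_hasDenominator {F : Cd d → Cd d} (hF : IsBallAutomorphism F) :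
    ∃ (b₀ : ℂ) (b : Fin d → ℂ), HasDenominator F b₀ b := by
  obtain ⟨hF, G, hG, hGF, hFG⟩ := hF
  have h0b : (0 : Cd d) ∈ unitBall d := mem_ball_self zero_lt_one
  set a := G 0 with ha
  have hab : a ∈ unitBall d := hG.2 h0b
  have han : ‖a‖ < 1 := mem_ball_zero_iff.1 hab
  have hpos : 0 < 1 - ‖a‖ ^ 2 := by nlinarith [norm_nonneg a]
  obtain ⟨s, hs, has⟩ : ∃ s : ℝ, 0 < s ∧ s ^ 2 = 1 - ‖a‖ ^ 2 :=
    ⟨√(1 - ‖a‖ ^ 2), Real.sqrt_pos.2 hpos, Real.sq_sqrt hpos.le⟩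
  have hφ := isHolomorphicSelfMap_ballInvolution han hs has
  have hφφ : ∀ z ∈ unitBall d, ballInvolution a s (ballInvolution a s z) = z := fun z hz =>
    ballInvolution_ballInvolution han hs has (mem_ball_zero_iff.1 hz).le
  have hφ0 : ballInvolution a s 0 = a := by simp [ballInvolution]
  have hφa : ballInvolution a s a = 0 := by rw [← hφ0]; simpa [hφ0] using hφφ 0 h0b
  set K : Cd d → Cd d := F ∘ ballInvolution a s with hK
  set K' : Cd d → Cd d := ballInvolution a s ∘ G with hK'
  have hKd : DifferentiableOn ℂ K (unitBall d) := hF.1.comp hφ.1 hφ.2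
  have hKm : MapsTo K (unitBall d) (unitBall d) := hF.2.comp hφ.2
  have hK0 : K 0 = 0 := by simp only [hK, Function.comp, hφ0]; exact hFG h0b
  have hK'0 : K' 0 = 0 := by simp only [hK', Function.comp, ← ha, hφa]
  have hK'K : ∀ z ∈ unitBall d, K' (K z) = z := fun z hz => by
    simp only [hK, hK', Function.comp]
    rw [hGF (hφ.2 hz), hφφ z hz]
  -- The Schwarz lemma for `K` and for its inverse `K'`, both fixing the origin.
  have hn : ∀ z ∈ unitBall d, ‖K z‖ = ‖z‖ := fun z hz => by
    refine le_antisymm ?_ ?_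
    · exact Complex.norm_le_norm_of_mapsTo_ball hKd
        (hKm.mono_right ball_subset_closedBall) hK0 (mem_ball_zero_iff.1 hz)
    · have := Complex.norm_le_norm_of_mapsTo_ball (f := K') (R := 1) (z := K z)
        (hφ.1.comp hG.1 hG.2)
        ((hφ.2.comp hG.2).mono_right ball_subset_closedBall) hK'0 (mem_ball_zero_iff.1 (hKm hz))
      rwa [hK'K z hz] at this
  set A := fderiv ℂ K 0
  have hFz : ∀ z ∈ unitBall d, F z = A (ballInvolution a s z) := fun z hz => by
    rw [← eq_fderiv_of_norm_eq hKd hn (hφ.2 hz), hK, Function.comp, hφφ z hz]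
  have haff : ∀ z, affineForm 1 (fun j => -(starRingEnd ℂ) (a j)) z = 1 - inner ℂ a z := fun z => by
    simp [affineForm, PiLp.inner_apply, sub_eq_add_neg, mul_comm]
  -- The linear part of `A` applied to the numerator of the involution; the constant part is `A a`.
  set L : Cd d →ₗ[ℂ] Cd d :=
    A.toLinearMap ∘ₗ (-((1 + (s : ℂ))⁻¹ • ((innerSL ℂ a).toLinearMap.smulRight a)) -
      (s : ℂ) • LinearMap.id) with hL
  refine ⟨1, fun j => -(starRingEnd ℂ) (a j), fun z hz => ?_, A a,
    fun j => L (EuclideanSpace.single j 1), fun z hz => ?_⟩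
  · rw [haff]
    exact one_sub_inner_ne_zero han (mem_closedBall_zero_iff.1 hz)
  · rw [hFz z hz, haff, sum_smul_map_single, ballInvolution, map_smul]
    congr 1
    simp only [hL, LinearMap.comp_apply, ContinuousLinearMap.coe_coe, ← map_add]
    congr 1
    simp only [LinearMap.sub_apply, LinearMap.neg_apply, LinearMap.smul_apply,
      LinearMap.smulRight_apply, ContinuousLinearMap.coe_coe, innerSL_apply_apply, LinearMap.id_apply]
    module

end BallSuperresolution

end

theorem mainTheorem3 (d : ℕ) (hd : 1 ≤ d) :
    ∃ C : ℂ → (Fin d → ℂ) → ℝ,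
      (∀ (b₀ : ℂ) (b : Fin d → ℂ), 0 < C b₀ b) ∧
      ∀ F : BallSuperresolution.Cd d → BallSuperresolution.Cd d,
        BallSuperresolution.IsBallAutomorphism F →
        BallSuperresolution.HasBoundedBoundaryValues F ∧
        (∃ (b₀ : ℂ) (b : Fin d → ℂ), BallSuperresolution.HasDenominator F b₀ b) ∧
        ∀ (b₀ : ℂ) (b : Fin d → ℂ), BallSuperresolution.HasDenominator F b₀ b →
          ∀ f : BallSuperresolution.Cd d → BallSuperresolution.Cd d,
            BallSuperresolution.IsHolomorphicSelfMap f →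
            BallSuperresolution.HasBoundedBoundaryValues f ∧
            ∀ ρ : ℝ,
              ρ = BallSuperresolution.sphereL2Norm (fun ξ =>
                BallSuperresolution.affineTaylor F ξ - BallSuperresolution.affineTaylor f ξ) →
              BallSuperresolution.sphereL2Norm (fun ξ =>
                  BallSuperresolution.boundaryValue F ξ -
                    BallSuperresolution.boundaryValue f ξ) ^ 2 ≤
                C b₀ b * ((d : ℝ) * ((d : ℝ) + 1) * ρ ^ 2 +
                  Real.sqrt ((d : ℝ) * ((d : ℝ) + 1)) * ρ) := by
  choose C hC hCle using fun (b₀ : ℂ) (b : Fin d → ℂ) =>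
    BallSuperresolution.exists_constant (d := d) b₀ b
  refine ⟨C, hC, fun F hF => ⟨hF.1.hasBoundedBoundaryValues, hF.exists_hasDenominator,
    fun b₀ b hb f hf => ⟨hf.hasBoundedBoundaryValues, ?_⟩⟩⟩
  rintro ρ rfl
  refine (hCle b₀ b F f hF hb hf).trans ?_
  have hd' : (1 : ℝ) ≤ d := by exact_mod_cast hd
  refine mul_le_mul_of_nonneg_left ?_ (hC b₀ b).le
  -- The bound linear in `ρ` already suffices: the quadratic term is dropped, and `d ≥ 1` gives
  -- `√(d(d+1)) ≥ 1`.
  refine le_add_of_nonneg_of_le (by positivity) ?_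
  refine le_mul_of_one_le_left ENNReal.toReal_nonneg ?_
  rw [Real.one_le_sqrt]
  nlinarith
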